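/- Let $q$ be a prime power and $d\ge 1$ an integer with $\gcd(q,d+1)=1$, and put $e=\gcd(q-1,d+1)$. Fix a non-trivial additive character $\psi:\mathbb F_q\to\mathbb C^\times$ and a multiplicative character $\chi:\mathbb F_q^\times\to\mathbb C^\times$ of order $q-1$. For $m\in\mathbb Z$ let $g(m)=\sum_{x\in\mathbb F_q^\times}\psi(x)\chi^m(x)$ be the Gauss sum, and for an integer vector $v=(v_1,\dots,v_k)$ let $g(v)=\prod_{i}g(v_i)$. Let $\gamma\in\mathbb Z^{d+2}$ have nonzero entries coprime to $q$, let $\delta\in\mathbb Z^{d+2}$, and let $N\ge1$ divide $q-1$. Put $\zeta_N=e^{2\pi i/N}$ and $\gamma^\gamma=\prod_j\gamma_j^{\gamma_j}\in\mathbb F_q^\times$. For $m\in\mathbb Z$ let $s_\delta(m)$ be the multiplicity of $e^{2\pi i m/(q-1)}$ as a zero of the greatest common divisor in $\mathbb C[T]$ of $\prod_{\gamma_j<0}(T^{-\gamma_j}-\zeta_N^{\delta_j})$ and $\prod_{\gamma_j>0}(T^{\gamma_j}-\zeta_N^{-\delta_j})$. For $t\in\mathbb F_q^\times$ define $$F_q(\gamma,\delta,N\mid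 t)=\frac1{1-q}\sum_{m=0}^{q-2}\left(\prod_{j=1}^{d+2}\frac{g\left(-\gamma_jm+\frac{\delta_j}{N}(q-1)\right)}{g\left(\frac{\delta_j}{N}(q-1)\right)}\right)q^{s_\delta(-m)-s_\delta(0)}\,\chi^m(\gamma^\gamma t),$$ which depends only on $\delta$ modulo $N$. For $u\in\mathbb F_q^\times$ let $X_u\subset\mathbb P^d$ be the hypersurface $$y_1^{d+1}+\cdots+y_{d+1}^{d+1}-(d+1)u^{-1}y_1\cdots y_{d+1}=0 .$$ Let $\gamma=(-d-1,1,\dots,1)\in\mathbb Z^{d+2}$, and for $\lambda=(\lambda_1,\dots,\lambda_{d-1})\in(\mathbb Z/e\mathbb Z)^{d-1}$ let $\delta(\lambda)=(0,\lambda_1,\dots,\lambda_{d-1},-\lambda_1-\cdots-\lambda_{d-1},0)$, where each $\lambda_i$ is replaced by any integer representative (the expressions below do not depend on this choice). Then $$\#X_u(\mathbb F_q)=\frac{q^d-1}{q-1}-\sum_{\lambda\in(\mathbb Z/e\mathbb Z)^{d-1}}g\left(\frac{q-1}{e}\,\delta(\lambda)\right)F_q\left(\gamma,\delta(\lambda),e\mid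 u^{d+1}\right).$$ -/

import Mathlib

open Polynomial

/-- The Gauss sum `g(m) = ∑_{x ∈ F^×} ψ(x) χ^m(x)` for an integer `m`.
(A multiplicative character takes the value `0` at `0`, also when it is trivial.) -/
noncomputable def gaussG {F : Type*} [Field F] [Fintype F]
    (ψ : AddChar F ℂ) (χ : MulChar F ℂ) (m : ℤ) : ℂ :=
  gaussSum (χ ^ m) ψ

/-- `g(v) = ∏_j g(v_j)` for an integer vector `v`. -/
noncomputable def gaussGVec {F : Type*} [Field F] [Fintype F]
    (ψ : AddChar F ℂ) (χ : MulChar F ℂ) {k : ℕ} (v : Fin k → ℤ) : ℂ :=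
  ∏ j, gaussG ψ χ (v j)

/-- `ζ_N = exp(2πi/N)`. -/
noncomputable def zetaRoot (N : ℕ) : ℂ :=
  Complex.exp (2 * Real.pi * Complex.I / N)

/-- The numerator `∏_{γ_j < 0} (T^{-γ_j} - ζ_N^{δ_j})` attached to `(γ, δ, N)`. -/
noncomputable def gammaNum {k : ℕ} (γ δ : Fin k → ℤ) (N : ℕ) : ℂ[X] :=
  ∏ j with γ j < 0, (X ^ (γ j).natAbs - C (zetaRoot N ^ δ j))

/-- The denominator `∏_{γ_j > 0} (T^{γ_j} - ζ_N^{-δ_j})` attached to `(γ, δ, N)`. -/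
noncomputable def gammaDen {k : ℕ} (γ δ : Fin k → ℤ) (N : ℕ) : ℂ[X] :=
  ∏ j with 0 < γ j, (X ^ (γ j).natAbs - C (zetaRoot N ^ (-δ j)))

open Classical in
/-- The greatest common divisor `D_{γ,δ,N}(T)` of numerator and denominator
(defined up to a nonzero constant, which does not affect multiplicities of zeros). -/
noncomputable def gammaGcd {k : ℕ} (γ δ : Fin k → ℤ) (N : ℕ) : ℂ[X] :=
  EuclideanDomain.gcd (gammaNum γ δ N) (gammaDen γ δ N)

/-- `s_δ(m)`: the multiplicity of the zero `exp(2πi m/(q-1))` of `D_{γ,δ,N}(T)`. -/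
noncomputable def gammaMult (q : ℕ) {k : ℕ} (γ δ : Fin k → ℤ) (N : ℕ) (m : ℤ) : ℕ :=
  (gammaGcd γ δ N).rootMultiplicity
    (Complex.exp (2 * Real.pi * Complex.I * m / ((q : ℂ) - 1)))

/-- The finite hypergeometric sum `F_q(γ, δ, N | t)`, `q = #F`, of a gamma triple `(γ, δ, N)`:
`1/(1-q) ∑_{m=0}^{q-2} ∏_j g(-γ_j m + δ_j(q-1)/N) / g(δ_j(q-1)/N) · q^{s(-m)-s(0)} · χ^m(γ^γ t)`,
where `γ^γ = ∏_j γ_j^{γ_j}`. It is used only when `q` is coprime to all `γ_j` and `N ∣ q - 1`,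
so that the divisions by `N` are exact and `γ^γ` is a unit of `F`. -/
noncomputable def finiteHypSum {F : Type*} [Field F] [Fintype F]
    (ψ : AddChar F ℂ) (χ : MulChar F ℂ) {k : ℕ} (γ δ : Fin k → ℤ) (N : ℕ) (t : F) : ℂ :=
  1 / (1 - (Fintype.card F : ℂ)) *
    ∑ m ∈ Finset.range (Fintype.card F - 1),
      (∏ j, gaussG ψ χ (-γ j * m + δ j * ((Fintype.card F : ℤ) - 1) / N) /
          gaussG ψ χ (δ j * ((Fintype.card F : ℤ) - 1) / N)) *
        (Fintype.card F : ℂ) ^ ((gammaMult (Fintype.card F) γ δ N (-(m : ℤ)) : ℤ)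
          - (gammaMult (Fintype.card F) γ δ N 0 : ℤ)) *
        (χ ^ m) ((∏ j, (γ j : F) ^ γ j) * t)

/-- The polynomial `y_1^{d+1} + ⋯ + y_{d+1}^{d+1} - u^{-1} (d+1) y_1 ⋯ y_{d+1}`. -/
noncomputable def dworkPoly {F : Type*} [Field F] (d : ℕ) (u : F) :
    MvPolynomial (Fin (d + 1)) F :=
  ∑ i, MvPolynomial.X i ^ (d + 1) -
    MvPolynomial.C (u⁻¹ * ((d : F) + 1)) * ∏ i, MvPolynomial.X i

/-- The set `X_u(F)` of `F`-rational points, in `ℙ^d(F)`, of the Dwork hypersurface. Its equation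
is homogeneous, so the choice of homogeneous coordinates does not matter (see below). -/
def dworkPoints {F : Type*} [Field F] (d : ℕ) (u : F) :
    Set (Projectivization F (Fin (d + 1) → F)) :=
  {P | MvPolynomial.eval P.rep (dworkPoly d u) = 0}

theorem mk_mem_dworkPoints {F : Type*} [Field F] (d : ℕ) (u : F) (y : Fin (d + 1) → F)
    (hy : y ≠ 0) :
    Projectivization.mk F y hy ∈ dworkPoints d u ↔
      ∑ i, y i ^ (d + 1) - u⁻¹ * ((d : F) + 1) * ∏ i, y i = 0 := by
  obtain ⟨a, ha⟩ := Projectivization.exists_smul_eq_mk_rep F y hy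
  simp only [dworkPoints, Set.mem_ofPred_eq, ← ha, dworkPoly, map_sub, map_sum, map_mul, map_pow,
    map_prod, MvPolynomial.eval_X, MvPolynomial.eval_C, Pi.smul_apply, Units.smul_def,
    smul_eq_mul, mul_pow, Finset.prod_mul_distrib, Finset.prod_const, Finset.card_univ,
    Fintype.card_fin, ← Finset.mul_sum]
  rw [show (a : F) ^ (d + 1) * ∑ i, y i ^ (d + 1) -
      u⁻¹ * ((d : F) + 1) * ((a : F) ^ (d + 1) * ∏ i, y i) =
      (a : F) ^ (d + 1) * (∑ i, y i ^ (d + 1) - u⁻¹ * ((d : F) + 1) * ∏ i, y i) by ring]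
  simp

/-- The vector `γ = (-d-1, 1, …, 1) ∈ ℤ^{d+2}`. -/
def dworkGamma (d : ℕ) : Fin (d + 2) → ℤ :=
  fun j => if j.val = 0 then -(d : ℤ) - 1 else 1

/-- The vector `(0, l_1, …, l_{d-1}, -l_1 - ⋯ - l_{d-1}, 0) ∈ ℤ^{d+2}` for `d ≥ 1`. -/
def dworkDelta (d : ℕ) (l : Fin (d - 1) → ℤ) : Fin (d + 2) → ℤ :=
  fun j =>
    if h : 1 ≤ j.val ∧ j.val < d then l ⟨j.val - 1, by omega⟩
    else if j.val = d then -∑ i, l i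
    else 0

/-- The integer vector `δ(λ)` for `λ ∈ (ℤ/e)^{d-1}`, formed with the representatives of the `λ_i`
in `{0, …, e-1}`. Another choice of representatives changes neither `g(((q-1)/e) δ(λ))` nor
`F_q(γ, δ(λ), e | t)` when `e ∣ q - 1` (see the next two lemmas). -/
def dworkDeltaMod (d e : ℕ) (l : Fin (d - 1) → ZMod e) : Fin (d + 2) → ℤ :=
  dworkDelta d (fun i => ((l i).val : ℤ))

theorem gaussG_congr {F : Type*} [Field F] [Fintype F]
    (ψ : AddChar F ℂ) (χ : MulChar F ℂ) {m m' : ℤ}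
    (h : m ≡ m' [ZMOD ((Fintype.card F : ℤ) - 1)]) : gaussG ψ χ m = gaussG ψ χ m' := by
  classical
  obtain ⟨c, hc⟩ := h.dvd
  have h1 : χ ^ ((Fintype.card F : ℤ) - 1) = 1 := by
    have h2 := χ.pow_card_eq_one
    rw [Fintype.card_units] at h2
    rw [← h2, ← zpow_natCast, Nat.cast_sub Fintype.card_pos, Nat.cast_one]
  have : m' = m + ((Fintype.card F : ℤ) - 1) * c := by linarith
  rw [gaussG, gaussG, this, zpow_add, zpow_mul, h1, one_zpow, mul_one]

theorem finiteHypSum_congr {F : Type*} [Field F] [Fintype F]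
    (ψ : AddChar F ℂ) (χ : MulChar F ℂ) {k : ℕ} (γ δ δ' : Fin k → ℤ) (N : ℕ) (hN : 0 < N)
    (h : ∀ j, δ j ≡ δ' j [ZMOD N]) (t : F) :
    finiteHypSum ψ χ γ δ N t = finiteHypSum ψ χ γ δ' N t := by
  have hz : ∀ a b : ℤ, a ≡ b [ZMOD N] → zetaRoot N ^ a = zetaRoot N ^ b := by
    intro a b hab
    obtain ⟨c, hc⟩ := hab.dvd
    have hp : zetaRoot N ^ N = 1 := (Complex.isPrimitiveRoot_exp N hN.ne').pow_eq_one
    have h0 : zetaRoot N ≠ 0 := Complex.exp_ne_zero _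
    rw [show b = a + N * c by linarith, zpow_add₀ h0, zpow_mul, zpow_natCast, hp, one_zpow,
      mul_one]
  have hs : ∀ m, gammaMult (Fintype.card F) γ δ N m = gammaMult (Fintype.card F) γ δ' N m := by
    intro m
    have e1 : gammaNum γ δ N = gammaNum γ δ' N :=
      Finset.prod_congr rfl fun j _ => by rw [hz _ _ (h j)]
    have e2 : gammaDen γ δ N = gammaDen γ δ' N :=
      Finset.prod_congr rfl fun j _ => by rw [hz _ _ (h j).neg]
    rw [gammaMult, gammaMult, gammaGcd, gammaGcd, e1, e2]
  have hd : ∀ j, δ j * ((Fintype.card F : ℤ) - 1) / N ≡ δ' j * ((Fintype.card F : ℤ) - 1) / N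
      [ZMOD ((Fintype.card F : ℤ) - 1)] := by
    intro j
    obtain ⟨c, hc⟩ := (h j).dvd
    have : δ' j * ((Fintype.card F : ℤ) - 1) / N =
        δ j * ((Fintype.card F : ℤ) - 1) / N + ((Fintype.card F : ℤ) - 1) * c := by
      rw [show δ' j * ((Fintype.card F : ℤ) - 1) = δ j * ((Fintype.card F : ℤ) - 1) +
          ((Fintype.card F : ℤ) - 1) * c * N by
        rw [show δ' j = δ j + N * c by linarith]; ring]
      exact Int.add_mul_ediv_right _ _ (by exact_mod_cast hN.ne')
    rw [this]
    exact (Int.modEq_iff_dvd.2 ⟨c, by ring⟩)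
  simp only [finiteHypSum, hs]
  congr 1
  refine Finset.sum_congr rfl fun m _ => ?_
  congr 2
  refine Finset.prod_congr rfl fun j _ => ?_
  rw [gaussG_congr ψ χ (hd j), gaussG_congr ψ χ ((hd j).add_left (-γ j * m))]

/-! Write `n = d + 1` and `q - 1 = e f`. Counting the points of the affine cone with an additive
character gives `q (1 + (q - 1) #X_u) = q ^ n + B + T`, where, for `t ≠ 0`, the vectors with a
vanishing coordinate give `B` (they do not see the monomial, so `B` belongs to the diagonal
hypersurface) and the torus gives `T` (`card_mul_affine_count`).

On the torus, one coordinate is scaled away, the monomial replaces another one, and the remaining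
`n`-th powers are detected by the characters of order dividing `e`, which form the index `λ`. A
Fourier expansion of `ψ` at the last argument then separates all variables, and
`T = ∑_λ ∑_m (∏_j g(-γ_j m + f δ_j)) χ^m(γ^γ u^n)` (`torus_sum_eq_gaussG`). Up to the factor
`1 / (1 - q)`, this is the sum of the `g(f δ) F_q` without the powers of `q`.

These powers account for `B`. The polynomial `T^n - 1` is separable, so `q^{s(-m) - s(0)}` is `1`
if `m ≡ f δ_j` for some `j ≥ 1` and `q⁻¹` otherwise (`gammaMult_dwork`). In the exceptional terms
`m = f a`, the factors `g(n m)` and `χ^m(γ^γ u^n)` are `-1` and `1`, and the differences `δ_j - a`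
run through the vectors of sum zero modulo `e` that have a zero entry (`sum_exceptional_terms`).
Those vectors also index the expansion of `B` (`sum_one_add_pow_sub_pow`): there
the difference of `n`-th powers of `1 + ∑_{r ≠ 0} ψ(t r^n)` and `∑_{r ≠ 0} ψ(t r^n)` leaves exactly
the index vectors with a zero entry, because the Gauss sum of the trivial character is `-1`. -/

/-! ### Orthogonality of characters and power residues -/

section CharacterSums

variable {G : Type*} [CommGroup G] [Fintype G]

theorem sum_zpow_char [IsCyclic G] (c : G →* ℂˣ) (hc : Function.Injective c) (m : ℤ) :
    ∑ r : G, ((c r ^ m : ℂˣ) : ℂ) =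
      if (Fintype.card G : ℤ) ∣ m then (Fintype.card G : ℂ) else 0 := by
  obtain ⟨g, hg⟩ := IsCyclic.exists_generator (α := G)
  have hord : orderOf g = Fintype.card G := by
    rw [← Nat.card_eq_fintype_card]; exact orderOf_eq_card_of_forall_mem_zpowers hg
  split_ifs with h
  · have : ∀ r : G, ((c r ^ m : ℂˣ) : ℂ) = 1 := by
      intro r
      obtain ⟨b, rfl⟩ := h
      rw [← map_zpow, zpow_mul, zpow_natCast, pow_card_eq_one, one_zpow, map_one, Units.val_one]
    simp [this]
  · have hne : ((c g ^ m : ℂˣ) : ℂ) ≠ 1 := by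
      intro h1
      apply h
      rw [← map_zpow, Units.val_eq_one] at h1
      have := hc (h1.trans (map_one c).symm)
      rw [← hord]
      exact orderOf_dvd_iff_zpow_eq_one.2 this
    have hs : ((c g ^ m : ℂˣ) : ℂ) * ∑ r : G, ((c r ^ m : ℂˣ) : ℂ) =
        ∑ r : G, ((c r ^ m : ℂˣ) : ℂ) := by
      rw [Finset.mul_sum]
      refine Fintype.sum_equiv (Equiv.mulLeft g) _ _ fun r => ?_
      rw [Equiv.coe_mulLeft, map_mul, mul_zpow, Units.val_mul]
    exact (mul_left_eq_self₀.1 hs).resolve_left hne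

theorem sum_range_pow_char [DecidableEq G] (c : G →* ℂˣ) (hc : Function.Injective c) (a : G) :
    ∑ m ∈ Finset.range (Fintype.card G), ((c a ^ m : ℂˣ) : ℂ) =
      if a = 1 then (Fintype.card G : ℂ) else 0 := by
  split_ifs with h
  · simp [h]
  · have hne : ((c a : ℂˣ) : ℂ) ≠ 1 := by
      intro h1
      exact h (hc ((Units.val_eq_one.1 h1).trans (map_one c).symm))
    simp only [Units.val_pow_eq_pow_val]
    rw [geom_sum_eq hne, ← Units.val_pow_eq_pow_val, ← map_pow, pow_card_eq_one]
    simp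

/-- The multiples of `f` below `e f`, indexed by residues modulo `e`. -/
theorem sum_range_mul_dvd {e f : ℕ} [NeZero e] (hf : 0 < f) (A : ℕ → ℂ) :
    ∑ m ∈ Finset.range (e * f), (if f ∣ m then A m else 0) = ∑ j : ZMod e, A (f * j.val) := by
  rw [← Finset.sum_filter]
  symm
  refine Finset.sum_bij (fun j _ => f * j.val) ?_ ?_ ?_ fun _ _ => rfl
  · intro j _
    rw [Finset.mem_filter, Finset.mem_range, mul_comm e f]
    exact ⟨Nat.mul_lt_mul_of_pos_left j.val_lt hf, dvd_mul_right _ _⟩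
  · intro a _ b _ h
    exact ZMod.val_injective e (Nat.eq_of_mul_eq_mul_left hf h)
  · intro m hm
    rw [Finset.mem_filter, Finset.mem_range] at hm
    obtain ⟨h, b, rfl⟩ := hm
    have hb : b < e := by
      rw [mul_comm e f] at h
      exact Nat.lt_of_mul_lt_mul_left h
    exact ⟨(b : ZMod e), Finset.mem_univ _, by rw [ZMod.val_cast_of_lt hb]⟩

/-- The number of `n`-th roots of `a`, by orthogonality of characters: only the characters
trivial on `n`-th powers, that is the powers of `c ^ f`, contribute. -/
theorem card_pow_eq [DecidableEq G] [IsCyclic G] (c : G →* ℂˣ) (hc : Function.Injective c)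
    {n e f : ℕ} [NeZero e] (hN : Fintype.card G = e * f) (he : e = Nat.gcd (Fintype.card G) n)
    (a : G) :
    ∑ r : G, (if r ^ n = a then (1 : ℂ) else 0) = ∑ j : ZMod e, ((c a ^ (f * j.val) : ℂˣ) : ℂ) := by
  have hN0 : (Fintype.card G : ℂ) ≠ 0 := Nat.cast_ne_zero.2 Fintype.card_ne_zero
  have hf : 0 < f := Nat.pos_of_ne_zero fun h => by simp [h] at hN
  have hdvd : ∀ m : ℕ, (Fintype.card G : ℤ) ∣ -((n * m : ℕ) : ℤ) ↔ f ∣ m := by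
    intro m
    rw [dvd_neg, Int.natCast_dvd_natCast]
    obtain ⟨n', hn'⟩ : e ∣ n := he ▸ Nat.gcd_dvd_right _ _
    have he0 : 0 < e := NeZero.pos e
    have hcop : Nat.Coprime f n' := by
      have : e * 1 = e * Nat.gcd f n' := by rw [← Nat.gcd_mul_left, ← hN, ← hn', ← he, mul_one]
      exact (Nat.eq_of_mul_eq_mul_left he0 this).symm
    rw [hN, hn', mul_assoc, Nat.mul_dvd_mul_iff_left he0]
    exact ⟨hcop.dvd_of_dvd_mul_left, fun h => h.mul_left _⟩
  apply mul_left_cancel₀ hN0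
  calc (Fintype.card G : ℂ) * ∑ r : G, (if r ^ n = a then (1 : ℂ) else 0)
      = ∑ r : G, ∑ m ∈ Finset.range (Fintype.card G), ((c (a * (r ^ n)⁻¹) ^ m : ℂˣ) : ℂ) := by
        rw [Finset.mul_sum]
        refine Finset.sum_congr rfl fun r _ => ?_
        rw [sum_range_pow_char c hc, mul_ite, mul_one, mul_zero]
        refine if_congr ?_ rfl rfl
        rw [mul_inv_eq_one, eq_comm]
    _ = ∑ m ∈ Finset.range (Fintype.card G), ((c a ^ m : ℂˣ) : ℂ) *
          ∑ r : G, ((c r ^ (-((n * m : ℕ) : ℤ)) : ℂˣ) : ℂ) := by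
        rw [Finset.sum_comm]
        refine Finset.sum_congr rfl fun m _ => ?_
        rw [Finset.mul_sum]
        refine Finset.sum_congr rfl fun r _ => ?_
        rw [← Units.val_mul, map_mul, map_inv, map_pow, mul_pow, zpow_neg, zpow_natCast, pow_mul,
          inv_pow]
    _ = (Fintype.card G : ℂ) * ∑ m ∈ Finset.range (e * f),
          (if f ∣ m then ((c a ^ m : ℂˣ) : ℂ) else 0) := by
        rw [Finset.mul_sum, hN]
        refine Finset.sum_congr rfl fun m _ => ?_
        rw [sum_zpow_char c hc, if_congr (hdvd m) rfl rfl, hN]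
        split_ifs <;> ring
    _ = _ := by rw [sum_range_mul_dvd hf]

/-- Sums over `n`-th powers, coordinate by coordinate, become sums over all vectors weighted by the
characters `c ^ (f l_i)`. -/
theorem sum_comp_pow [IsCyclic G] (c : G →* ℂˣ) (hc : Function.Injective c)
    {n e f : ℕ} [NeZero e] (hN : Fintype.card G = e * f) (he : e = Nat.gcd (Fintype.card G) n)
    {ι : Type*} [Fintype ι] [DecidableEq ι] (φ : (ι → G) → ℂ) :
    ∑ r : ι → G, φ (fun i => r i ^ n) =
      ∑ a : ι → G, φ a * ∑ l : ι → ZMod e, ∏ i, ((c (a i) ^ (f * (l i).val) : ℂˣ) : ℂ) := by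
  classical
  have h1 : ∀ a : ι → G, ∑ l : ι → ZMod e, ∏ i, ((c (a i) ^ (f * (l i).val) : ℂˣ) : ℂ) =
      ∑ r : ι → G, (if (fun i => r i ^ n) = a then 1 else 0) := by
    intro a
    have h2 := Finset.prod_univ_sum (fun _ : ι => (Finset.univ : Finset (ZMod e)))
      (fun i j => ((c (a i) ^ (f * j.val) : ℂˣ) : ℂ))
    have h3 := Finset.prod_univ_sum (fun _ : ι => (Finset.univ : Finset G))
      (fun i r => if r ^ n = a i then (1 : ℂ) else 0)
    rw [Fintype.piFinset_univ] at h2 h3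
    rw [← h2, ← Finset.prod_congr rfl fun i _ => card_pow_eq c hc hN he (a i), h3]
    refine Finset.sum_congr rfl fun r _ => ?_
    rw [Finset.prod_ite_zero]
    simp [funext_iff]
  simp_rw [h1, Finset.mul_sum]
  rw [Finset.sum_comm]
  refine Finset.sum_congr rfl fun r _ => ?_
  simp

end CharacterSums

/-! ### Gauss sums as sums over units -/

section GaussSums

variable {F : Type*} [Field F] [Fintype F]

theorem gaussG_zero {ψ : AddChar F ℂ} (hψ : ψ ≠ 1) (χ : MulChar F ℂ) : gaussG ψ χ 0 = -1 := by
  rw [gaussG, zpow_zero, gaussSum_one_left hψ]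

theorem gaussG_ne_zero {ψ : AddChar F ℂ} (hψ : ψ ≠ 1) (χ : MulChar F ℂ) (m : ℤ) :
    gaussG ψ χ m ≠ 0 := by
  by_cases h : χ ^ m = 1
  · rw [gaussG, h, gaussSum_one_left hψ]
    norm_num
  · exact gaussSum_ne_zero_of_nontrivial (Nat.cast_ne_zero.2 Fintype.card_ne_zero) h
      (AddChar.IsPrimitive.of_ne_one hψ)

variable [DecidableEq F]

/-- A character of maximal order takes a generator of `Fˣ` to a root of unity of order `q - 1`,
and so is faithful. -/
theorem toUnitHom_injective (χ : MulChar F ℂ) (hχ : orderOf χ = Fintype.card F - 1) :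
    Function.Injective χ.toUnitHom := by
  rw [injective_iff_map_eq_one]
  intro a ha
  obtain ⟨g, hg⟩ := IsCyclic.exists_generator (α := Fˣ)
  obtain ⟨k, rfl⟩ := Subgroup.mem_zpowers_iff.1 (hg a)
  have hord : orderOf g = Fintype.card F - 1 := by
    rw [orderOf_eq_card_of_forall_mem_zpowers hg, Nat.card_eq_fintype_card,
      Fintype.card_units]
  have hdvd : orderOf χ ∣ orderOf (χ.toUnitHom g) := by
    refine orderOf_dvd_of_pow_eq_one ?_
    ext b
    obtain ⟨l, rfl⟩ := Subgroup.mem_zpowers_iff.1 (hg b)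
    rw [MulChar.pow_apply_coe, MulChar.one_apply_coe, ← MulChar.coe_toUnitHom,
      ← Units.val_pow_eq_pow_val, map_zpow, ← zpow_natCast, zpow_comm, zpow_natCast,
      pow_orderOf_eq_one, one_zpow, Units.val_one]
  rw [map_zpow] at ha
  rw [← orderOf_dvd_iff_zpow_eq_one, hord, ← hχ]
  exact (Int.natCast_dvd_natCast.2 hdvd).trans (orderOf_dvd_iff_zpow_eq_one.2 ha)

theorem sum_eq_zero_add_sum_units {M : Type*} [AddCommMonoid M] (φ : F → M) :
    ∑ x, φ x = φ 0 + ∑ x : Fˣ, φ x := by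
  rw [Fintype.sum_eq_add_sum_subtype_ne φ 0]
  congr 1
  exact (Fintype.sum_equiv unitsEquivNeZero _ _ fun _ => rfl).symm

theorem gaussG_eq_sum_units (ψ : AddChar F ℂ) (χ : MulChar F ℂ) (m : ℤ) :
    gaussG ψ χ m = ∑ x : Fˣ, ((χ.toUnitHom x ^ m : ℂˣ) : ℂ) * ψ x := by
  rw [gaussG, gaussSum, sum_eq_zero_add_sum_units, MulChar.map_zero, zero_mul, zero_add]
  refine Finset.sum_congr rfl fun x _ => ?_
  rw [MulChar.zpow_apply_coe, ← map_zpow, MulChar.coe_toUnitHom, Units.val_zpow_eq_zpow_val]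

/-- Fourier expansion of the additive character on `Fˣ`. -/
theorem sum_gaussG_mul_pow (ψ : AddChar F ℂ) (χ : MulChar F ℂ)
    (hχ : orderOf χ = Fintype.card F - 1) (v : Fˣ) :
    ∑ m ∈ Finset.range (Fintype.card F - 1),
      gaussG ψ χ (-(m : ℤ)) * ((χ.toUnitHom v ^ m : ℂˣ) : ℂ) =
        ((Fintype.card F : ℂ) - 1) * ψ v := by
  simp_rw [gaussG_eq_sum_units, Finset.sum_mul]
  rw [Finset.sum_comm]
  have h : ∀ x : Fˣ, ∑ m ∈ Finset.range (Fintype.card F - 1),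
      ((χ.toUnitHom x ^ (-(m : ℤ)) : ℂˣ) : ℂ) * ψ x * ((χ.toUnitHom v ^ m : ℂˣ) : ℂ) =
      if x = v then ((Fintype.card F : ℂ) - 1) * ψ x else 0 := by
    intro x
    have h1 := sum_range_pow_char χ.toUnitHom (toUnitHom_injective χ hχ) (v * x⁻¹)
    rw [Fintype.card_units, Nat.cast_sub Fintype.card_pos, Nat.cast_one] at h1
    rw [if_congr (show x = v ↔ v * x⁻¹ = 1 by rw [mul_inv_eq_one, eq_comm]) rfl rfl,
      ← zero_mul (ψ x), ← ite_mul, ← h1, Finset.sum_mul]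
    refine Finset.sum_congr rfl fun m _ => ?_
    rw [map_mul, map_inv, mul_pow, zpow_neg, zpow_natCast, inv_pow, Units.val_mul]
    ring
  simp_rw [h]
  simp

end GaussSums

/-! ### Points with and without a vanishing coordinate -/

section PointCount

theorem addChar_sum {F ι : Type*} [AddCommMonoid F] (ψ : AddChar F ℂ) (s : Finset ι) (a : ι → F) :
    ψ (∑ i ∈ s, a i) = ∏ i ∈ s, ψ (a i) := by
  classical
  induction s using Finset.induction_on with
  | empty => simp
  | insert i s hi ih => rw [Finset.sum_insert hi, Finset.prod_insert hi, ψ.map_add_eq_mul, ih]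

variable {F : Type*} [Field F] [Fintype F] [DecidableEq F]

/-- The affine cone over `X_u` is the origin together with `q - 1` vectors over each point. -/
theorem card_dworkPoints_mul (d : ℕ) (u : F) :
    (Nat.card (dworkPoints d u) : ℂ) * ((Fintype.card F : ℂ) - 1) + 1 =
      ∑ y : Fin (d + 1) → F,
        if ∑ i, y i ^ (d + 1) - u⁻¹ * ((d : F) + 1) * ∏ i, y i = 0 then 1 else 0 := by
  set p : (Fin (d + 1) → F) → Prop :=
    fun y => ∑ i, y i ^ (d + 1) - u⁻¹ * ((d : F) + 1) * ∏ i, y i = 0 with hp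
  have hmk : ∀ y hy, Projectivization.mk F y hy ∈ dworkPoints d u ↔ p y :=
    mk_mem_dworkPoints d u
  have hp0 : p 0 := by simp [hp]
  have hsmul : ∀ (a : Fˣ) (y : Fin (d + 1) → F) (hy : y ≠ 0), p (a • y) ↔ p y := by
    intro a y hy
    have hay : a • y ≠ 0 := (smul_ne_zero_iff_ne a).2 hy
    rw [← hmk _ hay, ← hmk _ hy,
      (Projectivization.mk_eq_mk_iff F _ _ hay hy).2 ⟨a, rfl⟩]
  have hrep : ∀ P : dworkPoints d u, p P.1.rep := by
    intro P
    rw [← hmk _ P.1.rep_nonzero, P.1.mk_rep]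
    exact P.2
  let Φ : dworkPoints d u × Fˣ → {y : Fin (d + 1) → F // p y ∧ y ≠ 0} := fun x =>
    ⟨x.2 • x.1.1.rep, (hsmul _ _ x.1.1.rep_nonzero).2 (hrep x.1),
      (smul_ne_zero_iff_ne _).2 x.1.1.rep_nonzero⟩
  have hΦ : Function.Bijective Φ := by
    constructor
    · rintro ⟨P, a⟩ ⟨Q, b⟩ h
      have h1 : a • P.1.rep = b • Q.1.rep := congrArg Subtype.val h
      have hPQ : P = Q := by
        apply Subtype.ext
        rw [← P.1.mk_rep, ← Q.1.mk_rep, Projectivization.mk_eq_mk_iff]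
        exact ⟨a⁻¹ * b, by rw [mul_smul, ← h1, inv_smul_smul]⟩
      subst hPQ
      have hab : (a : F) = b := smul_left_injective F P.1.rep_nonzero h1
      rw [Units.ext hab]
    · rintro ⟨y, hy, hy0⟩
      obtain ⟨a, ha⟩ := Projectivization.exists_smul_eq_mk_rep F y hy0
      refine ⟨⟨⟨Projectivization.mk F y hy0, (hmk y hy0).2 hy⟩, a⁻¹⟩, ?_⟩
      apply Subtype.ext
      change a⁻¹ • (Projectivization.mk F y hy0).rep = y
      rw [← ha, inv_smul_smul]
  have h1 : Nat.card (dworkPoints d u) * (Fintype.card F - 1) =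
      (Finset.univ.filter fun y : Fin (d + 1) → F => p y ∧ y ≠ 0).card := by
    rw [← Fintype.card_subtype, ← Nat.card_eq_fintype_card (α := {y // p y ∧ y ≠ 0}),
      ← Nat.card_congr (Equiv.ofBijective Φ hΦ), Nat.card_prod,
      Nat.card_eq_fintype_card (α := Fˣ), Fintype.card_units]
  have h2 : (Finset.univ.filter fun y : Fin (d + 1) → F => p y) =
      insert 0 (Finset.univ.filter fun y : Fin (d + 1) → F => p y ∧ y ≠ 0) := by
    ext y
    simp only [Finset.mem_filter, Finset.mem_univ, true_and, Finset.mem_insert]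
    by_cases hy : y = 0
    · simp [hy, hp0]
    · simp [hy]
  rw [Finset.sum_boole, h2, Finset.card_insert_of_notMem (by simp), ← h1]
  push_cast [Nat.cast_sub (Fintype.card_pos (α := F))]
  ring

/-- Two functions that agree on the vectors with a vanishing coordinate have the same sum over
those vectors. -/
theorem sum_sub_sum_units {ι : Type*} [Fintype ι] [DecidableEq ι] (φ₁ φ₂ : (ι → F) → ℂ)
    (h : ∀ y, (∃ i, y i = 0) → φ₁ y = φ₂ y) :
    ∑ y, φ₁ y - ∑ y : ι → Fˣ, φ₁ (fun i => y i) = ∑ y, φ₂ y - ∑ y : ι → Fˣ, φ₂ (fun i => y i) := by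
  have h1 : ∑ y : ι → Fˣ, (φ₁ (fun i => y i) - φ₂ (fun i => y i)) = ∑ y, (φ₁ y - φ₂ y) := by
    refine Fintype.sum_of_injective (fun (y : ι → Fˣ) i => (y i : F)) ?_ _ _ ?_ fun _ => rfl
    · intro y z hyz
      funext i
      exact Units.ext (congrFun hyz i)
    · intro y hy
      rw [sub_eq_zero]
      apply h
      by_contra! hne
      exact hy ⟨fun i => Units.mk0 (y i) (hne i), rfl⟩
  rw [Finset.sum_sub_distrib, Finset.sum_sub_distrib] at h1
  linear_combination -h1

/-- Sums of an additive character over `n`-th powers are combinations of Gauss sums of the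
characters whose order divides `e = gcd(q - 1, n)`. -/
theorem sum_units_char_pow (ψ : AddChar F ℂ) (χ : MulChar F ℂ)
    (hχ : orderOf χ = Fintype.card F - 1) {n e f : ℕ} [NeZero e]
    (hN : Fintype.card F - 1 = e * f) (he : e = Nat.gcd (Fintype.card F - 1) n) (t : Fˣ) :
    ∑ r : Fˣ, ψ (t * (r : F) ^ n) = ∑ j : ZMod e, gaussG ψ χ ((f * j.val : ℕ) : ℤ) *
      ((χ.toUnitHom t⁻¹ ^ (f * j.val) : ℂˣ) : ℂ) := by
  have hc := toUnitHom_injective χ hχ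
  rw [← Fintype.card_units] at hN he
  calc ∑ r : Fˣ, ψ (t * (r : F) ^ n)
      = ∑ a : Fˣ, ψ (t * a) * ∑ r : Fˣ, (if r ^ n = a then (1 : ℂ) else 0) := by
        simp_rw [Finset.mul_sum]
        rw [Finset.sum_comm]
        refine Finset.sum_congr rfl fun r _ => ?_
        simp
    _ = ∑ a : Fˣ, ψ (t * a) * ∑ j : ZMod e, ((χ.toUnitHom a ^ (f * j.val) : ℂˣ) : ℂ) :=
        Finset.sum_congr rfl fun a _ => by rw [card_pow_eq _ hc hN he]
    _ = ∑ a : Fˣ, ψ a * ∑ j : ZMod e, ((χ.toUnitHom (t⁻¹ * a) ^ (f * j.val) : ℂˣ) : ℂ) := by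
        refine Fintype.sum_equiv (Equiv.mulLeft t) _ _ fun a => ?_
        rw [Equiv.coe_mulLeft, inv_mul_cancel_left, Units.val_mul]
    _ = _ := by
        simp_rw [Finset.mul_sum]
        rw [Finset.sum_comm]
        refine Finset.sum_congr rfl fun j _ => ?_
        rw [gaussG_eq_sum_units, Finset.sum_mul]
        refine Finset.sum_congr rfl fun a _ => ?_
        rw [map_mul, mul_pow, Units.val_mul, zpow_natCast]
        ring

/-- Summing over the scaling variable `t` forces the indices to add up to zero. -/
theorem sum_pow_char_combination (χ : MulChar F ℂ)
    (hχ : orderOf χ = Fintype.card F - 1) {e f : ℕ} [NeZero e]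
    (hN : Fintype.card F - 1 = e * f) (n : ℕ) (w : ZMod e → ℂ) :
    ∑ t : Fˣ, (∑ j : ZMod e, w j * ((χ.toUnitHom t⁻¹ ^ (f * j.val) : ℂˣ) : ℂ)) ^ n =
      ((Fintype.card F : ℂ) - 1) * ∑ j : Fin n → ZMod e, if ∑ i, j i = 0 then ∏ i, w (j i) else 0 := by
  have hc := toUnitHom_injective χ hχ
  have hq : 0 < Fintype.card F - 1 := Nat.sub_pos_of_lt Fintype.one_lt_card
  have hf : 0 < f := Nat.pos_of_ne_zero fun h => by simp [h] at hN; omega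
  simp_rw [Fintype.sum_pow]
  rw [Finset.sum_comm, Finset.mul_sum]
  refine Finset.sum_congr rfl fun j _ => ?_
  have h1 : ∀ t : Fˣ, ∏ i, w (j i) * ((χ.toUnitHom t⁻¹ ^ (f * (j i).val) : ℂˣ) : ℂ) =
      (∏ i, w (j i)) * ((χ.toUnitHom t ^ (-((f * ∑ i, (j i).val : ℕ) : ℤ)) : ℂˣ) : ℂ) := by
    intro t
    rw [Finset.prod_mul_distrib, ← Units.coe_prod, Finset.prod_pow_eq_pow_sum, ← Finset.mul_sum,
      map_inv, inv_pow, zpow_neg, zpow_natCast]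
  simp_rw [h1]
  rw [← Finset.mul_sum, sum_zpow_char _ hc]
  have h2 : (Fintype.card Fˣ : ℤ) ∣ -((f * ∑ i, (j i).val : ℕ) : ℤ) ↔ ∑ i, j i = 0 := by
    rw [dvd_neg, Int.natCast_dvd_natCast, Fintype.card_units, hN, mul_comm e f,
      Nat.mul_dvd_mul_iff_left hf, ← ZMod.natCast_eq_zero_iff]
    simp
  rw [if_congr h2 rfl rfl, Fintype.card_units, Nat.cast_sub Fintype.card_pos]
  split_ifs <;> simp [mul_comm]

/-- The contribution of the vectors having a vanishing coordinate. Allowing `r = 0` adds `1`, which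
cancels the Gauss sum of the trivial character, so the two powers differ in exactly the index
vectors that have a zero entry. -/
theorem sum_one_add_pow_sub_pow {ψ : AddChar F ℂ} (hψ : ψ ≠ 1) (χ : MulChar F ℂ)
    (hχ : orderOf χ = Fintype.card F - 1) {n e f : ℕ} [NeZero e]
    (hN : Fintype.card F - 1 = e * f) (he : e = Nat.gcd (Fintype.card F - 1) n) :
    ∑ t : Fˣ, ((1 + ∑ r : Fˣ, ψ (t * (r : F) ^ n)) ^ n - (∑ r : Fˣ, ψ (t * (r : F) ^ n)) ^ n) =
      -((Fintype.card F : ℂ) - 1) * ∑ j : Fin n → ZMod e,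
        if ∑ i, j i = 0 ∧ ∃ i, j i = 0 then ∏ i, gaussG ψ χ ((f * (j i).val : ℕ) : ℤ) else 0 := by
  have h1 : ∀ t : Fˣ, 1 + ∑ r : Fˣ, ψ (t * (r : F) ^ n) =
      ∑ j : ZMod e, (if j = 0 then 0 else gaussG ψ χ ((f * j.val : ℕ) : ℤ)) *
        ((χ.toUnitHom t⁻¹ ^ (f * j.val) : ℂˣ) : ℂ) := by
    intro t
    rw [sum_units_char_pow ψ χ hχ hN he, ← Finset.add_sum_erase _ _ (Finset.mem_univ (0 : ZMod e)),
      ← Finset.add_sum_erase _ (fun j : ZMod e => (if j = 0 then 0 else _) * _)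
        (Finset.mem_univ (0 : ZMod e)), ← add_assoc]
    congr 1
    · simp [gaussG_zero hψ]
    · refine Finset.sum_congr rfl fun j hj => ?_
      rw [if_neg (Finset.ne_of_mem_erase hj)]
  rw [Finset.sum_sub_distrib]
  simp_rw [h1]
  simp_rw [sum_units_char_pow ψ χ hχ hN he]
  rw [sum_pow_char_combination χ hχ hN n, sum_pow_char_combination χ hχ hN n, ← mul_sub, neg_mul,
    ← mul_neg]
  congr 1
  rw [← Finset.sum_sub_distrib, ← Finset.sum_neg_distrib]
  refine Finset.sum_congr rfl fun j _ => ?_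
  by_cases hs : ∑ i, j i = 0
  · by_cases hz : ∃ i, j i = 0
    · obtain ⟨i, hi⟩ := hz
      rw [if_pos hs, if_pos hs, if_pos ⟨hs, i, hi⟩, sub_eq_neg_self]
      exact Finset.prod_eq_zero (Finset.mem_univ i) (if_pos hi)
    · rw [if_pos hs, if_pos hs, if_neg fun h => hz h.2, neg_zero, sub_eq_zero]
      exact Finset.prod_congr rfl fun i _ => if_neg fun h => hz ⟨i, h⟩
  · simp [hs]

/-- The number of affine solutions: the trivial term, the vectors with a vanishing coordinate
(which do not see the monomial `∏ y_i`), and the sum over the torus. -/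
theorem card_mul_affine_count {ψ : AddChar F ℂ} (hψ : ψ ≠ 1) (n : ℕ) (hn : n ≠ 0) (b : F) :
    (Fintype.card F : ℂ) * ∑ y : Fin n → F, (if ∑ i, y i ^ n - b * ∏ i, y i = 0 then 1 else 0) =
      (Fintype.card F : ℂ) ^ n +
      ∑ t : Fˣ, ((1 + ∑ r : Fˣ, ψ (t * (r : F) ^ n)) ^ n - (∑ r : Fˣ, ψ (t * (r : F) ^ n)) ^ n) +
      ∑ t : Fˣ, ∑ y : Fin n → Fˣ, ψ (t * (∑ i, (y i : F) ^ n - b * ∏ i, (y i : F))) := by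
  have h1 : (Fintype.card F : ℂ) *
      ∑ y : Fin n → F, (if ∑ i, y i ^ n - b * ∏ i, y i = 0 then (1 : ℂ) else 0) =
      ∑ t : F, ∑ y : Fin n → F, ψ (t * (∑ i, y i ^ n - b * ∏ i, y i)) := by
    rw [Finset.sum_comm, Finset.mul_sum]
    refine Finset.sum_congr rfl fun y _ => ?_
    rw [AddChar.sum_mulShift _ (AddChar.IsPrimitive.of_ne_one hψ)]
    split_ifs <;> simp
  rw [h1, sum_eq_zero_add_sum_units, add_assoc, ← Finset.sum_add_distrib]
  congr 1
  · simp
  refine Finset.sum_congr rfl fun t _ => ?_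
  have h2 := sum_sub_sum_units (fun y : Fin n → F => ψ (t * (∑ i, y i ^ n - b * ∏ i, y i)))
    (fun y => ψ (t * ∑ i, y i ^ n)) (by
      rintro y ⟨i, hi⟩
      rw [Finset.prod_eq_zero (Finset.mem_univ i) hi, mul_zero, sub_zero])
  have h3 : ∑ y : Fin n → F, ψ (t * ∑ i, y i ^ n) = (1 + ∑ r : Fˣ, ψ (t * (r : F) ^ n)) ^ n := by
    have := sum_eq_zero_add_sum_units (fun x : F => ψ (t * x ^ n))
    simp only [zero_pow hn, mul_zero, AddChar.map_zero_eq_one] at this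
    rw [← this, Fintype.sum_pow]
    refine Finset.sum_congr rfl fun y _ => ?_
    rw [Finset.mul_sum, addChar_sum]
  have h4 : ∑ y : Fin n → Fˣ, ψ (t * ∑ i, (y i : F) ^ n) = (∑ r : Fˣ, ψ (t * (r : F) ^ n)) ^ n := by
    rw [Fintype.sum_pow]
    refine Finset.sum_congr rfl fun y _ => ?_
    rw [Finset.mul_sum, addChar_sum]
  rw [h3, h4] at h2
  linear_combination h2

end PointCount

/-! ### The sum over the torus -/

theorem Fin.sum_univ_pi_succ_succ {α M : Type*} [Fintype α] [AddCommMonoid M] (k : ℕ)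
    (φ : (Fin (k + 2) → α) → M) :
    ∑ y, φ y = ∑ a, ∑ b, ∑ r : Fin k → α, φ (Fin.cons a (Fin.cons b r)) := by
  have h : ∀ (l : ℕ) (φ : (Fin (l + 1) → α) → M),
      ∑ y, φ y = ∑ a, ∑ r : Fin l → α, φ (Fin.cons a r) := by
    intro l φ
    rw [← Fintype.sum_equiv (Fin.consEquiv fun _ : Fin (l + 1) => α) (fun x => φ (Fin.cons x.1 x.2))
      φ fun _ => rfl, Fintype.sum_prod_type]
  rw [h]
  exact Finset.sum_congr rfl fun a _ => h k _

section TorusSum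

variable {F : Type*} [Field F] [Fintype F] [DecidableEq F]

/-- Dehomogenization of the sum over the torus, in which the monomial is then used as a coordinate
in place of one of the variables. -/
theorem torus_sum_dehomogenize (ψ : AddChar F ℂ) (k : ℕ) (b : Fˣ) :
    ∑ t : Fˣ, ∑ y : Fin (k + 2) → Fˣ, ψ (t * (∑ i, (y i : F) ^ (k + 2) - b * ∏ i, (y i : F))) =
      ((Fintype.card F : ℂ) - 1) * ∑ x : Fˣ, ∑ w : Fˣ, ∑ r : Fin k → Fˣ,
        ψ (x + w + ∑ i, (x : F) * (r i : F) ^ (k + 2) +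
          ((x * (w * (x * -b)⁻¹) ^ (k + 2) * (∏ i, r i ^ (k + 2))⁻¹ : Fˣ) : F)) := by
  have h1 : ∀ y₀ : Fˣ, ∑ t : Fˣ, ∑ s : Fˣ, ∑ r : Fin k → Fˣ,
      ψ (t * ((y₀ : F) ^ (k + 2) + (s : F) ^ (k + 2) + ∑ i, (r i : F) ^ (k + 2) -
        b * (y₀ * (s * ∏ i, (r i : F))))) =
      ∑ x : Fˣ, ∑ w : Fˣ, ∑ r : Fin k → Fˣ,
        ψ (x + w + ∑ i, (x : F) * (r i : F) ^ (k + 2) +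
          ((x * (w * (x * -b)⁻¹) ^ (k + 2) * (∏ i, r i ^ (k + 2))⁻¹ : Fˣ) : F)) := by
    intro y₀
    -- Divide all coordinates by `y₀` and put `x = t y₀ ^ (k + 2)`.
    calc _ = ∑ x : Fˣ, ∑ s : Fˣ, ∑ r : Fin k → Fˣ,
          ψ (x * (1 + (s : F) ^ (k + 2) + ∑ i, (r i : F) ^ (k + 2) -
            b * (s * ∏ i, (r i : F)))) := by
          refine Fintype.sum_equiv (Equiv.mulRight (y₀ ^ (k + 2))) _ _ fun t => ?_
          refine Fintype.sum_equiv (Equiv.mulLeft y₀⁻¹) _ _ fun s => ?_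
          refine Fintype.sum_equiv (Equiv.mulLeft fun _ => y₀⁻¹) _ _ fun r => ?_
          have hy : (y₀ : F) ≠ 0 := y₀.ne_zero
          congr 1
          simp only [Equiv.coe_mulLeft, Equiv.coe_mulRight, Pi.mul_apply, Units.val_mul,
            Units.val_pow_eq_pow_val, Units.val_inv_eq_inv_val, mul_pow, inv_pow, Finset.prod_mul_distrib,
            Finset.prod_const, Finset.card_univ, Fintype.card_fin, ← Finset.mul_sum]
          field_simp
          ring
      _ = ∑ x : Fˣ, ∑ r : Fin k → Fˣ, ∑ s : Fˣ,
          ψ (x * (1 + (s : F) ^ (k + 2) + ∑ i, (r i : F) ^ (k + 2) -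
            b * (s * ∏ i, (r i : F)))) := Finset.sum_congr rfl fun x _ => Finset.sum_comm
      _ = ∑ x : Fˣ, ∑ r : Fin k → Fˣ, ∑ w : Fˣ,
          ψ (x + w + ∑ i, (x : F) * (r i : F) ^ (k + 2) +
            ((x * (w * (x * -b)⁻¹) ^ (k + 2) * (∏ i, r i ^ (k + 2))⁻¹ : Fˣ) : F)) := by
          refine Finset.sum_congr rfl fun x _ => Finset.sum_congr rfl fun r _ => ?_
          -- The monomial `-b x s ∏ r_i` becomes the coordinate `w` that replaces `s`.
          refine Fintype.sum_equiv (Equiv.mulLeft (x * -b * ∏ i, r i)) _ _ fun s => ?_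
          have e1 : x * (x * -b * (∏ i, r i) * s * (x * -b)⁻¹) ^ (k + 2) *
              (∏ i, r i ^ (k + 2))⁻¹ = x * s ^ (k + 2) := by
            rw [Finset.prod_pow, mul_assoc (x * -b), mul_inv_cancel_comm, mul_pow,
              mul_comm (_ ^ _) (s ^ _), ← mul_assoc, mul_inv_cancel_right]
          congr 1
          rw [Equiv.coe_mulLeft, e1, ← Finset.mul_sum]
          push_cast
          ring
      _ = _ := Finset.sum_congr rfl fun x _ => Finset.sum_comm
  calc _ = ∑ t : Fˣ, ∑ y₀ : Fˣ, ∑ s : Fˣ, ∑ r : Fin k → Fˣ,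
      ψ (t * ((y₀ : F) ^ (k + 2) + (s : F) ^ (k + 2) + ∑ i, (r i : F) ^ (k + 2) -
        b * (y₀ * (s * ∏ i, (r i : F))))) := by
        refine Finset.sum_congr rfl fun t _ => ?_
        rw [Fin.sum_univ_pi_succ_succ]
        refine Finset.sum_congr rfl fun y₀ _ => Finset.sum_congr rfl fun s _ =>
          Finset.sum_congr rfl fun r _ => ?_
        simp only [Fin.sum_univ_succ, Fin.prod_univ_succ, Fin.cons_zero, Fin.cons_succ, add_assoc]
    _ = _ := by
        rw [Finset.sum_comm, Finset.sum_congr rfl fun y₀ _ => h1 y₀, Finset.sum_const,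
          nsmul_eq_mul, Finset.card_univ, Fintype.card_units, Nat.cast_sub Fintype.card_pos,
          Nat.cast_one]

theorem Finset.sum_rotate {α β γ M : Type*} [AddCommMonoid M] (s : Finset α) (t : Finset β)
    (u : Finset γ) (A : α → β → γ → M) :
    ∑ x ∈ s, ∑ l ∈ t, ∑ m ∈ u, A x l m = ∑ l ∈ t, ∑ m ∈ u, ∑ x ∈ s, A x l m := by
  rw [Finset.sum_comm]
  exact Finset.sum_congr rfl fun l _ => Finset.sum_comm

/-- Apart from `x` and `w`, the summand depends on `r` only through the powers `r_i ^ (k + 2)`.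
The new variables are `z_i = x r_i ^ (k + 2)`, and the exponents of `x` in the last term add up to
`1 - (k + 2) + k = -1`. -/
theorem torus_sum_power_residues (ψ : AddChar F ℂ) (c : Fˣ →* ℂˣ) (hc : Function.Injective c)
    (k : ℕ) {e f : ℕ} [NeZero e] (hN : Fintype.card Fˣ = e * f)
    (he : e = Nat.gcd (Fintype.card Fˣ) (k + 2)) (b x w : Fˣ) :
    ∑ r : Fin k → Fˣ, ψ (x + w + ∑ i, (x : F) * (r i : F) ^ (k + 2) +
      ((x * (w * (x * -b)⁻¹) ^ (k + 2) * (∏ i, r i ^ (k + 2))⁻¹ : Fˣ) : F)) =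
      ∑ z : Fin k → Fˣ, ψ (x + w + ∑ i, (z i : F) +
        (((-b)⁻¹ ^ (k + 2) * w ^ (k + 2) * (x * ∏ i, z i)⁻¹ : Fˣ) : F)) *
          ∑ l : Fin k → ZMod e, ∏ i, ((c (x⁻¹ * z i) ^ (f * (l i).val) : ℂˣ) : ℂ) := by
  have h := sum_comp_pow c hc hN he (fun a : Fin k → Fˣ =>
    ψ (x + w + ∑ i, (x : F) * (a i : F) +
      ((x * (w * (x * -b)⁻¹) ^ (k + 2) * (∏ i, a i)⁻¹ : Fˣ) : F)))
  simp only [Units.val_pow_eq_pow_val (_ : Fˣ)] at h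
  rw [h]
  refine Fintype.sum_equiv (Equiv.mulLeft fun _ => x) _ _ fun a => ?_
  have e1 : x * (w * (x * -b)⁻¹) ^ (k + 2) * (∏ i, a i)⁻¹ =
      (-b)⁻¹ ^ (k + 2) * w ^ (k + 2) * (x * ∏ i, x * a i)⁻¹ := by
    rw [Finset.prod_mul_distrib, Finset.prod_const, Finset.card_univ, Fintype.card_fin,
      mul_inv x, mul_pow, mul_pow, mul_inv x, mul_inv (x ^ k), pow_add x⁻¹ k 2,
      ← inv_pow x k, pow_two x⁻¹]
    calc _ = (x * x⁻¹) * ((-b)⁻¹ ^ (k + 2) * w ^ (k + 2) * (x⁻¹ * (x⁻¹ ^ k * (∏ i, a i)⁻¹))) := by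
          simp only [mul_comm, mul_left_comm, mul_assoc]
      _ = _ := by rw [mul_inv_cancel, one_mul]
  rw [e1]
  simp only [Equiv.coe_mulLeft, Pi.mul_apply, inv_mul_cancel_left, Units.val_mul x]

theorem gaussG_prod_eq_sum (ψ : AddChar F ℂ) (χ : MulChar F ℂ) (k : ℕ) (u v : ℤ) (a : Fin k → ℤ) :
    gaussG ψ χ u * (∏ i, gaussG ψ χ (a i)) * gaussG ψ χ v =
      ∑ x : Fˣ, ∑ w : Fˣ, ∑ z : Fin k → Fˣ,
        (((χ.toUnitHom w ^ u : ℂˣ) : ℂ) * ψ w) *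
          (∏ i, ((χ.toUnitHom (z i) ^ a i : ℂˣ) : ℂ) * ψ (z i)) *
          (((χ.toUnitHom x ^ v : ℂˣ) : ℂ) * ψ x) := by
  simp only [gaussG_eq_sum_units, ← Finset.sum_mul, ← Finset.mul_sum]
  rw [Finset.prod_univ_sum, Fintype.piFinset_univ]

theorem torus_character_factor {G H : Type*} [CommGroup G] [CommGroup H] (c : G →* H) (k f m : ℕ)
    (D x w : G) (z : Fin k → G) (l : Fin k → ℕ) :
    c (D * w ^ (k + 2) * (x * ∏ i, z i)⁻¹) ^ m * ∏ i, c (x⁻¹ * z i) ^ (f * l i) =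
      c w ^ (((k + 2 : ℕ) : ℤ) * m) * (∏ i, c (z i) ^ (-m + (f * l i : ℕ) : ℤ)) *
        c x ^ (-m - (f * ∑ i, l i : ℕ) : ℤ) * c D ^ m := by
  have e2 : c w ^ (((k + 2 : ℕ) : ℤ) * m) = (c w ^ (k + 2)) ^ m := by
    rw [zpow_mul, zpow_natCast, zpow_natCast]
  have e3 : ∏ i, c (z i) ^ (-m + (f * l i : ℕ) : ℤ) =
      ((∏ i, c (z i)) ^ m)⁻¹ * ∏ i, c (z i) ^ (f * l i) := by
    simp only [zpow_add, zpow_neg, zpow_natCast, Finset.prod_mul_distrib, Finset.prod_inv_distrib,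
      Finset.prod_pow]
  have e4 : c x ^ (-m - (f * ∑ i, l i : ℕ) : ℤ) = (c x ^ m)⁻¹ * (c x ^ (f * ∑ i, l i))⁻¹ := by
    rw [zpow_sub, zpow_neg, zpow_natCast, zpow_natCast]
  have e5 : ∏ i, c (x⁻¹ * z i) ^ (f * l i) =
      (c x ^ (f * ∑ i, l i))⁻¹ * ∏ i, c (z i) ^ (f * l i) := by
    simp only [map_mul, map_inv, mul_pow, inv_pow, Finset.prod_mul_distrib,
      Finset.prod_inv_distrib, Finset.prod_pow_eq_pow_sum, ← Finset.mul_sum]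
  have e6 : c (D * w ^ (k + 2) * (x * ∏ i, z i)⁻¹) ^ m =
      c D ^ m * (c w ^ (k + 2)) ^ m * ((c x ^ m)⁻¹ * ((∏ i, c (z i)) ^ m)⁻¹) := by
    simp only [map_mul, map_inv, map_prod, map_pow, mul_pow, inv_pow, mul_inv]
  rw [e2, e3, e4, e5, e6]
  simp only [mul_comm, mul_left_comm, mul_assoc]

/-- The sum over the torus in terms of Gauss sums. The indices `l` detect the power residues
`r_i ^ (k + 2)`, the index `m` comes from the Fourier expansion of `ψ` at the last coordinate. -/
theorem torus_sum_eq_gaussG (ψ : AddChar F ℂ) (χ : MulChar F ℂ)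
    (hχ : orderOf χ = Fintype.card F - 1) (k : ℕ) {e f : ℕ} [NeZero e]
    (hN : Fintype.card F - 1 = e * f) (he : e = Nat.gcd (Fintype.card F - 1) (k + 2)) (b : Fˣ) :
    ∑ t : Fˣ, ∑ y : Fin (k + 2) → Fˣ, ψ (t * (∑ i, (y i : F) ^ (k + 2) - b * ∏ i, (y i : F))) =
      ∑ l : Fin k → ZMod e, ∑ m ∈ Finset.range (Fintype.card F - 1),
        gaussG ψ χ (((k + 2 : ℕ) : ℤ) * m) * (∏ i, gaussG ψ χ (-m + (f * (l i).val : ℕ))) *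
          gaussG ψ χ (-m - (f * ∑ i, (l i).val : ℕ)) * gaussG ψ χ (-m) *
          ((χ.toUnitHom ((-b)⁻¹ ^ (k + 2)) ^ m : ℂˣ) : ℂ) := by
  have hc := toUnitHom_injective χ hχ
  have hN' := hN
  have he' := he
  rw [← Fintype.card_units] at hN' he'
  set D : Fˣ := (-b)⁻¹ ^ (k + 2) with hD
  have h3 : ∀ (x w : Fˣ) (z : Fin k → Fˣ) (l : Fin k → ZMod e) (m : ℕ),
      ψ (x + w + ∑ i, (z i : F)) *
          ((χ.toUnitHom (D * w ^ (k + 2) * (x * ∏ i, z i)⁻¹) ^ m : ℂˣ) : ℂ) *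
        ∏ i, ((χ.toUnitHom (x⁻¹ * z i) ^ (f * (l i).val) : ℂˣ) : ℂ) =
      ((((χ.toUnitHom w ^ (((k + 2 : ℕ) : ℤ) * m) : ℂˣ) : ℂ)) * ψ w) *
        (∏ i, ((χ.toUnitHom (z i) ^ (-m + (f * (l i).val : ℕ) : ℤ) : ℂˣ) : ℂ) * ψ (z i)) *
        ((((χ.toUnitHom x ^ (-m - (f * ∑ i, (l i).val : ℕ) : ℤ) : ℂˣ) : ℂ)) * ψ x) *
        ((χ.toUnitHom D ^ m : ℂˣ) : ℂ) := by
    intro x w z l m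
    have e5 := congrArg (fun y : ℂˣ => (y : ℂ))
      (torus_character_factor χ.toUnitHom k f m D x w z fun i => (l i).val)
    simp only [Units.val_mul (α := ℂ), Units.coe_prod] at e5
    rw [ψ.map_add_eq_mul, ψ.map_add_eq_mul, addChar_sum, Finset.prod_mul_distrib,
      mul_assoc (_ * _ * _ : ℂ), e5]
    ring
  have h4 : ∀ (x w : Fˣ) (z : Fin k → Fˣ) (l : Fin k → ZMod e),
      ((Fintype.card F : ℂ) - 1) * (ψ (x + w + ∑ i, (z i : F) +
        ((D * w ^ (k + 2) * (x * ∏ i, z i)⁻¹ : Fˣ) : F)) *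
          ∏ i, ((χ.toUnitHom (x⁻¹ * z i) ^ (f * (l i).val) : ℂˣ) : ℂ)) =
      ∑ m ∈ Finset.range (Fintype.card F - 1), gaussG ψ χ (-m) *
        (((((χ.toUnitHom w ^ (((k + 2 : ℕ) : ℤ) * m) : ℂˣ) : ℂ)) * ψ w) *
        (∏ i, ((χ.toUnitHom (z i) ^ (-m + (f * (l i).val : ℕ) : ℤ) : ℂˣ) : ℂ) * ψ (z i)) *
        ((((χ.toUnitHom x ^ (-m - (f * ∑ i, (l i).val : ℕ) : ℤ) : ℂˣ) : ℂ)) * ψ x) *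
        ((χ.toUnitHom D ^ m : ℂˣ) : ℂ)) := by
    intro x w z l
    simp_rw [← h3]
    rw [ψ.map_add_eq_mul (x + w + ∑ i, (z i : F))]
    have h := sum_gaussG_mul_pow ψ χ hχ (D * w ^ (k + 2) * (x * ∏ i, z i)⁻¹)
    rw [← mul_assoc, mul_left_comm, ← h, Finset.mul_sum, Finset.sum_mul]
    exact Finset.sum_congr rfl fun m _ => by ring
  calc _ = ∑ x : Fˣ, ∑ w : Fˣ, ∑ z : Fin k → Fˣ, ∑ l : Fin k → ZMod e,
        ∑ m ∈ Finset.range (Fintype.card F - 1), gaussG ψ χ (-m) *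
        (((((χ.toUnitHom w ^ (((k + 2 : ℕ) : ℤ) * m) : ℂˣ) : ℂ)) * ψ w) *
        (∏ i, ((χ.toUnitHom (z i) ^ (-m + (f * (l i).val : ℕ) : ℤ) : ℂˣ) : ℂ) * ψ (z i)) *
        ((((χ.toUnitHom x ^ (-m - (f * ∑ i, (l i).val : ℕ) : ℤ) : ℂˣ) : ℂ)) * ψ x) *
        ((χ.toUnitHom D ^ m : ℂˣ) : ℂ)) := by
        rw [torus_sum_dehomogenize, Finset.mul_sum]
        refine Finset.sum_congr rfl fun x _ => ?_
        rw [Finset.mul_sum]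
        refine Finset.sum_congr rfl fun w _ => ?_
        rw [torus_sum_power_residues ψ _ hc k hN' he', Finset.mul_sum]
        refine Finset.sum_congr rfl fun z _ => ?_
        rw [Finset.mul_sum, Finset.mul_sum]
        exact Finset.sum_congr rfl fun l _ => h4 x w z l
    _ = _ := by
        rw [Finset.sum_congr rfl fun x _ => (Finset.sum_congr rfl fun w _ =>
          Finset.sum_rotate _ _ _ _).trans (Finset.sum_rotate _ _ _ _), Finset.sum_rotate]
        refine Finset.sum_congr rfl fun l _ => Finset.sum_congr rfl fun m _ => ?_
        rw [mul_right_comm _ (gaussG ψ χ (-m)), gaussG_prod_eq_sum]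
        simp only [Finset.mul_sum, Finset.sum_mul]
        exact Finset.sum_congr rfl fun x _ => Finset.sum_congr rfl fun w _ =>
          Finset.sum_congr rfl fun z _ => by ring

end TorusSum

/-! ### The vectors `γ` and `δ(λ)` -/

section DworkVectors

theorem dworkGamma_zero (k : ℕ) : dworkGamma (k + 1) 0 = -((k + 2 : ℕ) : ℤ) := by
  simp [dworkGamma]; ring

theorem dworkGamma_succ (k : ℕ) (j : Fin (k + 2)) : dworkGamma (k + 1) j.succ = 1 := by
  simp [dworkGamma]

theorem dworkDeltaMod_zero (k e : ℕ) (l : Fin k → ZMod e) : dworkDeltaMod (k + 1) e l 0 = 0 := by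
  simp [dworkDeltaMod, dworkDelta]

theorem dworkDeltaMod_castSucc (k e : ℕ) (l : Fin k → ZMod e) (i : Fin k) :
    dworkDeltaMod (k + 1) e l i.castSucc.castSucc.succ = (l i).val := by
  simp [dworkDeltaMod, dworkDelta]

theorem dworkDeltaMod_last_castSucc (k e : ℕ) (l : Fin k → ZMod e) :
    dworkDeltaMod (k + 1) e l (Fin.last k).castSucc.succ = -((∑ i, (l i).val : ℕ) : ℤ) := by
  simp [dworkDeltaMod, dworkDelta]

theorem dworkDeltaMod_last (k e : ℕ) (l : Fin k → ZMod e) :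
    dworkDeltaMod (k + 1) e l (Fin.last (k + 1)).succ = 0 := by
  simp [dworkDeltaMod, dworkDelta]

/-- The entries of `δ(λ)` other than the first are `0`, `-∑ λ_i` and the `λ_i`. -/
theorem exists_dworkDeltaMod_iff (k e : ℕ) (l : Fin k → ZMod e) (p : ℤ → Prop) :
    (∃ j : Fin (k + 2), p (dworkDeltaMod (k + 1) e l j.succ)) ↔
      p 0 ∨ p (-((∑ i, (l i).val : ℕ) : ℤ)) ∨ ∃ i, p (l i).val := by
  constructor
  · rintro ⟨j, hj⟩
    induction j using Fin.lastCases with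
    | last => exact Or.inl (dworkDeltaMod_last k e l ▸ hj)
    | cast j =>
      induction j using Fin.lastCases with
      | last => exact Or.inr (Or.inl (dworkDeltaMod_last_castSucc k e l ▸ hj))
      | cast i => exact Or.inr (Or.inr ⟨i, dworkDeltaMod_castSucc k e l i ▸ hj⟩)
  · rintro (h | h | ⟨i, h⟩)
    · exact ⟨Fin.last _, (dworkDeltaMod_last k e l).symm ▸ h⟩
    · exact ⟨(Fin.last k).castSucc, (dworkDeltaMod_last_castSucc k e l).symm ▸ h⟩
    · exact ⟨i.castSucc.castSucc, (dworkDeltaMod_castSucc k e l i).symm ▸ h⟩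

end DworkVectors

/-! ### The exponent of `q` -/

section Multiplicity

theorem rootMultiplicity_gcd_of_separable [DecidableEq ℂ[X]] {p r : ℂ[X]} (hp : p.Separable) (z : ℂ) :
    (EuclideanDomain.gcd p r).rootMultiplicity z = if p.IsRoot z ∧ r.IsRoot z then 1 else 0 := by
  have hp0 : p ≠ 0 := hp.ne_zero
  have hg0 : EuclideanDomain.gcd p r ≠ 0 := fun h => hp0 (EuclideanDomain.gcd_eq_zero_iff.1 h).1
  have hle : (EuclideanDomain.gcd p r).rootMultiplicity z ≤ 1 :=
    rootMultiplicity_le_one_of_separable (hp.of_dvd (EuclideanDomain.gcd_dvd_left p r)) z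
  have hroot : p.IsRoot z ∧ r.IsRoot z ↔ (EuclideanDomain.gcd p r).IsRoot z := by
    simp only [← dvd_iff_isRoot]
    exact ⟨fun h => EuclideanDomain.dvd_gcd h.1 h.2,
      fun h => ⟨h.trans (EuclideanDomain.gcd_dvd_left p r),
        h.trans (EuclideanDomain.gcd_dvd_right p r)⟩⟩
  rw [if_congr hroot rfl rfl]
  split_ifs with h
  · exact le_antisymm hle ((rootMultiplicity_pos hg0).2 h)
  · exact rootMultiplicity_eq_zero h

/-- The gcd divides the separable polynomial `T ^ (k + 2) - 1`, so the multiplicity is `0` or `1`;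
it is `1` exactly when `m` cancels one of the shifts `f δ_j`, `j ≥ 1`, that is, when one of the
Gauss sums attached to `-m` has trivial multiplicative character. -/
theorem gammaMult_dwork (k e f : ℕ) [NeZero e] (hf : 0 < f) (hek : e ∣ k + 2)
    (q : ℕ) (hq : q = e * f + 1) (l : Fin k → ZMod e) (m : ℤ) :
    gammaMult q (dworkGamma (k + 1)) (dworkDeltaMod (k + 1) e l) e m =
      if ∃ j : Fin (k + 2), ((e * f : ℕ) : ℤ) ∣ m + f * dworkDeltaMod (k + 1) e l j.succ
      then 1 else 0 := by
  classical
  have he0 : e ≠ 0 := NeZero.ne e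
  have hf0 : f ≠ 0 := hf.ne'
  have hN0 : e * f ≠ 0 := mul_ne_zero he0 hf0
  set δ := dworkDeltaMod (k + 1) e l with hδ
  have hδ0 : δ 0 = 0 := dworkDeltaMod_zero k e l
  have hγ0 : dworkGamma (k + 1) 0 = -((k + 2 : ℕ) : ℤ) := dworkGamma_zero k
  have hγs : ∀ j : Fin (k + 2), dworkGamma (k + 1) j.succ = 1 := dworkGamma_succ k
  have hnum : gammaNum (dworkGamma (k + 1)) δ e = X ^ (k + 2) - 1 := by
    have : (Finset.univ.filter fun j => dworkGamma (k + 1) j < 0) = {0} := by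
      ext j
      refine Fin.cases ?_ (fun i => ?_) j
      · simp [hγ0]; omega
      · simp [hγs]
    rw [gammaNum, this, Finset.prod_singleton, hγ0, hδ0, zpow_zero, map_one, Int.natAbs_neg,
      Int.natAbs_natCast]
  have hden : gammaDen (dworkGamma (k + 1)) δ e =
      ∏ j : Fin (k + 2), (X - C (zetaRoot e ^ (-δ j.succ))) := by
    rw [gammaDen, Finset.prod_filter, Fin.prod_univ_succ, hγ0, if_neg (by omega), one_mul]
    refine Finset.prod_congr rfl fun j _ => ?_
    rw [hγs, if_pos one_pos, Int.natAbs_one, pow_one]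
  set ω : ℂ := Complex.exp (2 * Real.pi * Complex.I / ((e * f : ℕ) : ℂ)) with hω
  have hprim : IsPrimitiveRoot ω (e * f) := Complex.isPrimitiveRoot_exp _ hN0
  have hω0 : ω ≠ 0 := Complex.exp_ne_zero _
  have hz : Complex.exp (2 * Real.pi * Complex.I * m / ((q : ℂ) - 1)) = ω ^ m := by
    rw [hω, ← Complex.exp_int_mul, hq]
    congr 1
    push_cast
    ring
  have hζ : zetaRoot e = ω ^ f := by
    rw [hω, ← Complex.exp_nat_mul, zetaRoot]
    congr 1
    push_cast
    have : (e : ℂ) ≠ 0 := Nat.cast_ne_zero.2 he0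
    have : (f : ℂ) ≠ 0 := Nat.cast_ne_zero.2 hf0
    field_simp
  have hroot : ∀ j : Fin (k + 2), ω ^ m = zetaRoot e ^ (-δ j.succ) ↔
      ((e * f : ℕ) : ℤ) ∣ m + f * δ j.succ := by
    intro j
    rw [← hprim.zpow_eq_one_iff_dvd, hζ, zpow_add₀ hω0, zpow_mul, zpow_natCast, zpow_neg,
      mul_eq_one_iff_eq_inv₀ (zpow_ne_zero _ (pow_ne_zero _ hω0))]
  have hsep : (X ^ (k + 2) - 1 : ℂ[X]).Separable :=
    (X_pow_sub_one_separable_iff).2 (Nat.cast_ne_zero.2 (by omega))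
  rw [gammaMult, gammaGcd, hnum, hden, hz, rootMultiplicity_gcd_of_separable hsep]
  refine if_congr ?_ rfl rfl
  have hden_root : (∏ j : Fin (k + 2), (X - C (zetaRoot e ^ (-δ j.succ)))).IsRoot (ω ^ m) ↔
      ∃ j : Fin (k + 2), ω ^ m = zetaRoot e ^ (-δ j.succ) := by
    rw [IsRoot, eval_prod, Finset.prod_eq_zero_iff]
    simp [sub_eq_zero]
  rw [hden_root, ← exists_congr hroot]
  refine ⟨And.right, fun h => ⟨?_, h⟩⟩
  -- A root of the denominator is an `e`-th root of unity, and `e` divides `k + 2`.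
  obtain ⟨j, hj⟩ := h
  obtain ⟨b, hb⟩ := hek
  have he1 : zetaRoot e ^ e = 1 := (Complex.isPrimitiveRoot_exp e he0).pow_eq_one
  have h1 : (ω ^ m) ^ e = 1 := by
    rw [hj, ← zpow_natCast, ← zpow_mul, mul_comm, zpow_mul, zpow_natCast, he1, one_zpow]
  rw [IsRoot, eval_sub, eval_pow, eval_X, eval_one, hb, pow_mul, h1, one_pow, sub_self]

end Multiplicity

/-! ### Comparison with the hypergeometric sums -/

section Assembly

variable {F : Type*} [Field F] [Fintype F]

theorem prod_gaussG_dwork (ψ : AddChar F ℂ) (χ : MulChar F ℂ) (k e f m : ℕ)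
    (l : Fin k → ZMod e) :
    ∏ j, gaussG ψ χ (-dworkGamma (k + 1) j * m + f * dworkDeltaMod (k + 1) e l j) =
      gaussG ψ χ (((k + 2 : ℕ) : ℤ) * m) * (∏ i, gaussG ψ χ (-m + (f * (l i).val : ℕ))) *
        gaussG ψ χ (-m - (f * ∑ i, (l i).val : ℕ)) * gaussG ψ χ (-m) := by
  rw [Fin.prod_univ_succ, Fin.prod_univ_castSucc, Fin.prod_univ_castSucc]
  simp only [dworkGamma_zero, dworkGamma_succ, dworkDeltaMod_zero, dworkDeltaMod_castSucc,
    dworkDeltaMod_last_castSucc, dworkDeltaMod_last, neg_neg, mul_zero, add_zero, neg_mul, one_mul,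
    mul_neg, ← sub_eq_add_neg, Nat.cast_mul]
  ring

theorem gaussG_mul_intCast (ψ : AddChar F ℂ) (χ : MulChar F ℂ) {e f : ℕ} [NeZero e]
    (hN : Fintype.card F - 1 = e * f) (x : ℤ) (j : ZMod e) (hx : (x : ZMod e) = j) :
    gaussG ψ χ (f * x) = gaussG ψ χ ((f * j.val : ℕ) : ℤ) := by
  apply gaussG_congr
  have h1 : (Fintype.card F : ℤ) - 1 = f * e := by
    rw [← Nat.cast_one, ← Nat.cast_sub Fintype.card_pos, hN]
    push_cast
    ring
  rw [h1, Nat.cast_mul]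
  refine Int.ModEq.mul_left' ?_
  rw [← ZMod.intCast_eq_intCast_iff, hx]
  simp

/-- The index vectors of sum zero are the translates `(-a, -∑ l_i - a, l_1 - a, …, l_k - a)`; the
sum vanishes because `e` divides the length `k + 2`. -/
theorem sum_zero_sum_reindex {e : ℕ} [NeZero e] (k : ℕ) (hek : e ∣ k + 2) (g : ZMod e → ℂ) :
    ∑ j : Fin (k + 2) → ZMod e, (if ∑ i, j i = 0 ∧ ∃ i, j i = 0 then ∏ i, g (j i) else 0) =
      ∑ a : ZMod e, ∑ l : Fin k → ZMod e, if a = 0 ∨ a = -∑ i, l i ∨ ∃ i, a = l i then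
        (∏ i, g (l i - a)) * g (-(∑ i, l i) - a) * g (-a) else 0 := by
  rw [Fin.sum_univ_pi_succ_succ]
  symm
  refine Fintype.sum_equiv (Equiv.neg _) _ _ fun a => ?_
  rw [Finset.sum_comm]
  refine Fintype.sum_equiv (Equiv.subRight fun _ => a) _ _ fun l => ?_
  have hk : ((k : ZMod e) + 2) = 0 := by exact_mod_cast (ZMod.natCast_eq_zero_iff (k + 2) e).2 hek
  have hsum : ∑ i, (l i - a) = (∑ i, l i) + 2 * a := by
    rw [Finset.sum_sub_distrib, Finset.sum_const, Finset.card_univ, Fintype.card_fin, nsmul_eq_mul]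
    linear_combination -a * hk
  rw [Finset.sum_eq_single (-(∑ i, l i) - a)]
  · simp only [Fin.sum_univ_succ, Fin.prod_univ_succ, Fin.exists_fin_succ, Fin.cons_zero,
      Fin.cons_succ, Equiv.neg_apply, Equiv.subRight_apply, Pi.sub_apply, hsum]
    refine if_congr ?_ (by ring) rfl
    have h1 : -a + (-(∑ i, l i) - a + ((∑ i, l i) + 2 * a)) = 0 := by ring
    simp only [h1, true_and, neg_eq_zero, sub_eq_zero]
    refine or_congr Iff.rfl (or_congr eq_comm (exists_congr fun i => eq_comm))
  · intro b _ hb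
    rw [if_neg]
    rintro ⟨h, -⟩
    simp only [Fin.sum_univ_succ, Fin.cons_zero, Fin.cons_succ, Equiv.neg_apply,
      Equiv.subRight_apply, Pi.sub_apply, hsum] at h
    exact hb (by linear_combination h)
  · simp

/-- The terms of the hypergeometric sums in which the power of `q` is trivial add up, after sign
change, to the Gauss sum products coming from the vectors with a vanishing coordinate. Such terms
have `f ∣ m`, so that `g((k + 2) m) = g(0) = -1` and the factor with `χ ^ m` is `1`. -/
theorem sum_exceptional_terms [DecidableEq F] {ψ : AddChar F ℂ} (hψ : ψ ≠ 1) (χ : MulChar F ℂ)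
    (k : ℕ) {e f : ℕ} [NeZero e] (hN : Fintype.card F - 1 = e * f) (hek : e ∣ k + 2) (b : Fˣ) :
    ∑ l : Fin k → ZMod e, ∑ m ∈ Finset.range (Fintype.card F - 1),
      (if ∃ j : Fin (k + 2), ((e * f : ℕ) : ℤ) ∣ -m + f * dworkDeltaMod (k + 1) e l j.succ then
        gaussG ψ χ (((k + 2 : ℕ) : ℤ) * m) * (∏ i, gaussG ψ χ (-m + (f * (l i).val : ℕ))) *
          gaussG ψ χ (-m - (f * ∑ i, (l i).val : ℕ)) * gaussG ψ χ (-m) *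
          ((χ.toUnitHom (b ^ (k + 2)) ^ m : ℂˣ) : ℂ) else 0) =
      -∑ j : Fin (k + 2) → ZMod e,
        if ∑ i, j i = 0 ∧ ∃ i, j i = 0 then ∏ i, gaussG ψ χ ((f * (j i).val : ℕ) : ℤ) else 0 := by
  have hq : 0 < Fintype.card F - 1 := Nat.sub_pos_of_lt Fintype.one_lt_card
  have hf : 0 < f := Nat.pos_of_ne_zero fun h => by simp [h] at hN; omega
  rw [sum_zero_sum_reindex k hek (fun j => gaussG ψ χ ((f * j.val : ℕ) : ℤ)), Finset.sum_comm,
    ← Finset.sum_neg_distrib]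
  have hdvd : ∀ (m : ℕ) (l : Fin k → ZMod e),
      (∃ j : Fin (k + 2), ((e * f : ℕ) : ℤ) ∣ -m + f * dworkDeltaMod (k + 1) e l j.succ) →
        f ∣ m := by
    rintro m l ⟨j, hj⟩
    have h1 : (f : ℤ) ∣ -m + f * dworkDeltaMod (k + 1) e l j.succ :=
      (Int.natCast_dvd_natCast.2 (dvd_mul_left f e)).trans hj
    rw [dvd_add_left (dvd_mul_right _ _), dvd_neg] at h1
    exact Int.natCast_dvd_natCast.1 h1
  rw [hN]
  calc _ = ∑ m ∈ Finset.range (e * f), (if f ∣ m then ∑ l : Fin k → ZMod e,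
      (if ∃ j : Fin (k + 2), ((e * f : ℕ) : ℤ) ∣ -m + f * dworkDeltaMod (k + 1) e l j.succ then
        gaussG ψ χ (((k + 2 : ℕ) : ℤ) * m) * (∏ i, gaussG ψ χ (-m + (f * (l i).val : ℕ))) *
          gaussG ψ χ (-m - (f * ∑ i, (l i).val : ℕ)) * gaussG ψ χ (-m) *
          ((χ.toUnitHom (b ^ (k + 2)) ^ m : ℂˣ) : ℂ) else 0) else 0) := by
        refine Finset.sum_congr rfl fun m _ => ?_
        split_ifs with h
        · rfl
        · exact Finset.sum_eq_zero fun l _ => if_neg fun hj => h (hdvd m l hj)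
    _ = _ := by
        rw [sum_range_mul_dvd hf]
        refine Finset.sum_congr rfl fun a _ => ?_
        rw [← Finset.sum_neg_distrib]
        refine Finset.sum_congr rfl fun l _ => ?_
        have hE : (∃ j : Fin (k + 2), ((e * f : ℕ) : ℤ) ∣ -((f * a.val : ℕ) : ℤ) +
            f * dworkDeltaMod (k + 1) e l j.succ) ↔ a = 0 ∨ a = -∑ i, l i ∨ ∃ i, a = l i := by
          have h1 : ∀ x : ℤ, ((e * f : ℕ) : ℤ) ∣ -((f * a.val : ℕ) : ℤ) + f * x ↔
              a = (x : ZMod e) := by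
            intro x
            rw [show -((f * a.val : ℕ) : ℤ) + f * x = (f : ℤ) * (x - a.val) by push_cast; ring,
              show ((e * f : ℕ) : ℤ) = (f : ℤ) * e by push_cast; ring,
              mul_dvd_mul_iff_left (by exact_mod_cast hf.ne'), ← ZMod.intCast_zmod_eq_zero_iff_dvd]
            push_cast
            rw [ZMod.natCast_zmod_val, sub_eq_zero, eq_comm]
          simp_rw [h1]
          rw [exists_dworkDeltaMod_iff k e l (fun x => a = (x : ZMod e))]
          simp
        rw [if_congr hE rfl rfl]
        split_ifs
        swap
        · exact neg_zero.symm
        have g1 : gaussG ψ χ (((k + 2 : ℕ) : ℤ) * (f * a.val : ℕ)) = -1 := by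
          rw [← gaussG_zero hψ χ]
          have h := gaussG_mul_intCast ψ χ hN (((k + 2 : ℕ) : ℤ) * a.val) 0 (by
            rw [Int.cast_mul, Int.cast_natCast, (ZMod.natCast_eq_zero_iff (k + 2) e).2 hek,
              zero_mul])
          rw [ZMod.val_zero, mul_zero, Nat.cast_zero] at h
          rw [← h]
          congr 1
          push_cast
          ring
        have g2 : ∀ i, gaussG ψ χ (-((f * a.val : ℕ) : ℤ) + (f * (l i).val : ℕ)) =
            gaussG ψ χ ((f * (l i - a).val : ℕ) : ℤ) := by
          intro i
          rw [← gaussG_mul_intCast ψ χ hN ((l i).val - a.val) (l i - a) (by simp)]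
          congr 1
          push_cast
          ring
        have g3 : gaussG ψ χ (-((f * a.val : ℕ) : ℤ) - (f * ∑ i, (l i).val : ℕ)) =
            gaussG ψ χ ((f * (-(∑ i, l i) - a).val : ℕ) : ℤ) := by
          rw [← gaussG_mul_intCast ψ χ hN (-(∑ i, (l i).val : ℕ) - a.val) (-(∑ i, l i) - a)
            (by simp)]
          congr 1
          push_cast
          ring
        have g4 : gaussG ψ χ (-((f * a.val : ℕ) : ℤ)) =
            gaussG ψ χ ((f * (-a).val : ℕ) : ℤ) := by
          rw [← gaussG_mul_intCast ψ χ hN (-a.val) (-a) (by simp)]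
          congr 1
          push_cast
          ring
        have g5 : χ.toUnitHom (b ^ (k + 2)) ^ (f * a.val) = 1 := by
          obtain ⟨c, hc⟩ := hek
          rw [← map_pow, ← pow_mul, hc, show e * c * (f * a.val) = (e * f) * (c * a.val) by ring,
            ← hN, ← Fintype.card_units, pow_mul, pow_card_eq_one, one_pow, map_one]
        simp only [g1, g2, g3, g4, g5, Units.val_one]
        ring

/-- The factor `g(f δ)` cancels the denominators of the hypergeometric sum, which are nonzero.
The exponent `s(-m) - s(0)` is `0` or `-1`, since `s(0) = 1` because of the last entry of `δ`. -/
theorem gaussGVec_mul_finiteHypSum {ψ : AddChar F ℂ} (hψ : ψ ≠ 1) (χ : MulChar F ℂ)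
    (k : ℕ) {e f : ℕ} [NeZero e] (hN : Fintype.card F - 1 = e * f) (hek : e ∣ k + 2)
    (l : Fin k → ZMod e) (t : F) (D : Fˣ)
    (hD : (∏ j, (dworkGamma (k + 1) j : F) ^ dworkGamma (k + 1) j) * t = D) :
    gaussGVec ψ χ (fun j => (f : ℤ) * dworkDeltaMod (k + 1) e l j) *
      finiteHypSum ψ χ (dworkGamma (k + 1)) (dworkDeltaMod (k + 1) e l) e t =
      1 / (1 - (Fintype.card F : ℂ)) * ∑ m ∈ Finset.range (Fintype.card F - 1),
        gaussG ψ χ (((k + 2 : ℕ) : ℤ) * m) * (∏ i, gaussG ψ χ (-m + (f * (l i).val : ℕ))) *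
          gaussG ψ χ (-m - (f * ∑ i, (l i).val : ℕ)) * gaussG ψ χ (-m) *
          ((χ.toUnitHom D ^ m : ℂˣ) : ℂ) *
          (if ∃ j : Fin (k + 2), ((e * f : ℕ) : ℤ) ∣ -m + f * dworkDeltaMod (k + 1) e l j.succ then
            1 else (Fintype.card F : ℂ)⁻¹) := by
  have hq : 0 < Fintype.card F - 1 := Nat.sub_pos_of_lt Fintype.one_lt_card
  have hf : 0 < f := Nat.pos_of_ne_zero fun h => by simp [h] at hN; omega
  have hcard : Fintype.card F = e * f + 1 := by omega
  have hdiv : ∀ x : ℤ, x * ((Fintype.card F : ℤ) - 1) / e = f * x := by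
    intro x
    rw [hcard]
    push_cast
    rw [show x * ((e : ℤ) * f + 1 - 1) = (f * x) * e by ring]
    exact Int.mul_ediv_cancel _ (by exact_mod_cast NeZero.ne e)
  have hs := gammaMult_dwork k e f hf hek _ hcard l
  have hs0 : gammaMult (Fintype.card F) (dworkGamma (k + 1)) (dworkDeltaMod (k + 1) e l) e 0 = 1 := by
    rw [hs, if_pos ⟨Fin.last _, by rw [dworkDeltaMod_last]; simp⟩]
  have hg0 : gaussGVec ψ χ (fun j => (f : ℤ) * dworkDeltaMod (k + 1) e l j) ≠ 0 :=
    Finset.prod_ne_zero_iff.2 fun j _ => gaussG_ne_zero hψ χ _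
  rw [gaussGVec] at hg0
  rw [gaussGVec, finiteHypSum, hD, mul_left_comm, Finset.mul_sum]
  congr 1
  refine Finset.sum_congr rfl fun m _ => ?_
  simp only [hdiv, hs0, Finset.prod_div_distrib, prod_gaussG_dwork, hs]
  rw [← mul_assoc, ← mul_assoc,
    mul_div_cancel₀ _ hg0, MulChar.pow_apply_coe, ← MulChar.coe_toUnitHom,
    ← Units.val_pow_eq_pow_val, mul_right_comm]
  congr 1
  split_ifs <;> simp

end Assembly

theorem theorem1p9 {F : Type*} [Field F] [Fintype F]
    (ψ : AddChar F ℂ) (hψ : ψ ≠ 1)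
    (χ : MulChar F ℂ) (hχ : orderOf χ = Fintype.card F - 1)
    (d : ℕ) (hd : 1 ≤ d) (q : ℕ) (hq : q = Fintype.card F) (hqd : Nat.gcd q (d + 1) = 1)
    (e : ℕ) [NeZero e] (he : e = Nat.gcd (q - 1) (d + 1))
    (u : F) (hu : u ≠ 0) :
    (Nat.card (dworkPoints d u) : ℂ) =
      ((q : ℂ) ^ d - 1) / ((q : ℂ) - 1) -
        ∑ l : Fin (d - 1) → ZMod e,
          gaussGVec ψ χ (fun j => (((q - 1) / e : ℕ) : ℤ) * dworkDeltaMod d e l j) *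
            finiteHypSum ψ χ (dworkGamma d) (dworkDeltaMod d e l) e (u ^ (d + 1)) := by
  classical
  obtain ⟨k, rfl⟩ : ∃ k, d = k + 1 := ⟨d - 1, by omega⟩
  subst hq
  obtain ⟨f, hN⟩ : e ∣ Fintype.card F - 1 := he ▸ Nat.gcd_dvd_left _ _
  have hek : e ∣ k + 2 := he ▸ Nat.gcd_dvd_right _ _
  have hfdiv : (Fintype.card F - 1) / e = f := by
    rw [hN, Nat.mul_div_cancel_left _ (NeZero.pos e)]
  have hn : ((k + 2 : ℕ) : F) ≠ 0 := by
    have h := (Nat.isCoprime_iff_coprime.2 hqd).map (Int.castRingHom F)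
    simp only [eq_intCast, Int.cast_natCast, Nat.cast_card_eq_zero, isCoprime_zero_left] at h
    exact h.ne_zero
  have hb0 : u⁻¹ * (((k + 1 : ℕ) : F) + 1) ≠ 0 :=
    mul_ne_zero (inv_ne_zero hu) (by exact_mod_cast hn)
  set b : Fˣ := Units.mk0 _ hb0 with hb
  have hD : (∏ j, (dworkGamma (k + 1) j : F) ^ dworkGamma (k + 1) j) * u ^ (k + 1 + 1) =
      (((-b)⁻¹ ^ (k + 2) : Fˣ) : F) := by
    rw [Fin.prod_univ_succ]
    simp only [dworkGamma_zero, dworkGamma_succ, Int.cast_one, zpow_one, Finset.prod_const_one,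
      mul_one, zpow_neg, zpow_natCast, Units.val_pow_eq_pow_val, Units.val_inv_eq_inv_val,
      Units.val_neg, hb, Units.val_mk0]
    rw [← inv_pow, ← mul_pow]
    congr 1
    push_cast at hn ⊢
    have : (k : F) + 1 + 1 ≠ 0 := by rw [add_assoc, one_add_one_eq_two]; exact hn
    field_simp
    ring
  have hq0 : (Fintype.card F : ℂ) ≠ 0 := Nat.cast_ne_zero.2 Fintype.card_ne_zero
  have hq1 : (Fintype.card F : ℂ) - 1 ≠ 0 :=
    sub_ne_zero.2 (by exact_mod_cast (Fintype.one_lt_card (α := F)).ne')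
  have hcount := card_dworkPoints_mul (k + 1) u
  have haff := card_mul_affine_count hψ (k + 2) (by omega) (b : F)
  rw [sum_one_add_pow_sub_pow hψ χ hχ hN he, torus_sum_eq_gaussG ψ χ hχ k hN he b] at haff
  have hexc := sum_exceptional_terms hψ χ k hN hek (-b)⁻¹
  rw [hfdiv]
  have hterm := fun l : Fin k → ZMod e =>
    gaussGVec_mul_finiteHypSum hψ χ k hN hek l (u ^ (k + 1 + 1)) _ hD
  -- The weight is `q⁻¹ + (1 - q⁻¹) [E l m]`.
  have hsplit : ∀ (A : (Fin k → ZMod e) → ℕ → ℂ) (E : (Fin k → ZMod e) → ℕ → Prop)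
      [∀ l m, Decidable (E l m)],
      ∑ l, 1 / (1 - (Fintype.card F : ℂ)) * ∑ m ∈ Finset.range (Fintype.card F - 1),
        A l m * (if E l m then 1 else (Fintype.card F : ℂ)⁻¹) =
      1 / (1 - (Fintype.card F : ℂ)) * ((Fintype.card F : ℂ)⁻¹ *
        (∑ l, ∑ m ∈ Finset.range (Fintype.card F - 1), A l m) + (1 - (Fintype.card F : ℂ)⁻¹) *
        ∑ l, ∑ m ∈ Finset.range (Fintype.card F - 1), if E l m then A l m else 0) := by
    intro A E _
    simp only [← Finset.mul_sum]
    simp only [Finset.mul_sum, ← Finset.sum_add_distrib]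
    refine Finset.sum_congr rfl fun l _ => Finset.sum_congr rfl fun m _ => ?_
    split_ifs <;> ring
  have htotal := (Finset.sum_congr rfl fun l _ => hterm l :
    ∑ l : Fin k → ZMod e, _ = ∑ l : Fin k → ZMod e, _)
  rw [hsplit, hexc] at htotal
  refine Eq.trans ?_ (congrArg (((Fintype.card F : ℂ) ^ (k + 1) - 1) /
    ((Fintype.card F : ℂ) - 1) - ·) htotal.symm)
  have hbv : (b : F) = u⁻¹ * (((k + 1 : ℕ) : F) + 1) := rfl
  rw [hbv, ← hcount] at haff
  rw [pow_succ] at haff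
  rw [← neg_sub (Fintype.card F : ℂ) 1, div_neg]
  field_simp
  linear_combination haff
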